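/- **Setting.** Write $M_n=M_n(\mathbb C)$. A *decomposition of length $l\ge 1$* consists of (possibly empty) compact metric spaces $X_1,\dots,X_l$, closed subsets $Y_i\subseteq X_i$ with $Y_1=\varnothing$, positive integers $n_1,\dots,n_l$, $*$-subalgebras $A^{(i)}\subseteq\bigoplus_{j\le i}C(X_j,M_{n_j})$ and unital $*$-homomorphisms $\varphi_i\colon A^{(i)}\to C(Y_{i+1},M_{n_{i+1}})$ ($1\le i<l$) such that $A^{(1)}=C(X_1,M_{n_1})$ and $A^{(i+1)}=\{(a,f)\in A^{(i)}\oplus C(X_{i+1},M_{n_{i+1}}):\varphi_i(a)=f|_{Y_{i+1}}\}$. The algebra $A=A^{(l)}$, with this decomposition, is a *DSH algebra of length $l$* if every $y\in Y_{i+1}$ ($1\le i<l$) *decomposes* into some list of points $x_1\in X_{i_1}\setminus Y_{i_1},\dots,x_t\in X_{i_t}\setminus Y_{i_t}$ with $i_1,\dots,i_t\le i$, i.e. $\varphi_i(f)(y)=\operatorname{diag}(f_{i_1}(x_1),\dots,f_{i_t}(x_t))$ for all $f=(f_1,\dots,f_i)\in A^{(i)}$. A $*$-homomorphism $\psi\colon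 A_1\to A_2$ of DSH algebras is *diagonal* if for every point $x$ of a base space $X_i^2$ of $A_2$ there are points $x_j\in X^1_{i_j}$ ($1\le j\le t$) of base spaces of $A_1$ with $\psi(f)_i(x)=\operatorname{diag}(f_{i_1}(x_1),\dots,f_{i_t}(x_t))$ for all $f\in A_1$. For a DSH algebra $A$ as above and a surjective $*$-homomorphism $\rho\colon A\to B$ onto a $\mathrm C^*$-algebra $B$, let $X_i'$ be the closure in $X_i$ of the set of those $x\in X_i\setminus Y_i$ for which the representation $\operatorname{ev}_x\colon f\mapsto f_i(x)$ is unitarily equivalent to $\pi\circ\rho$ for some irreducible representation $\pi$ of $B$, and let $Y_i'=X_i'\cap Y_i$. **Theorem.** 1. Let $A$ be a DSH algebra of length $l$ and $\rho\colon A\to B$ a surjective $*$-homomorphism onto a $\mathrm C^*$-algebra. There is a DSH algebra $D$ of length $l$ with base spaces $X_i'$, closed subsets $Y_i'$ and matrix sizes $n_i$ such that: (a) whenever $y\in Y_{i+1}'$ decomposes into $x_1,\dots,x_t$ in $A$, with $x_j\in X_{i_j}\setminus Y_{i_j}$, then $x_j\in X_{i_j}'$ for all $j$, and the pullback map $\tau_i$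 of $D$ satisfies $\tau_i(f)(y)=\operatorname{diag}(f_{i_1}(x_1),\dots,f_{i_t}(x_t))$ for all $f\in D^{(i)}$; (b) for all $i$, each $(f_1,\dots,f_i)\in D^{(i)}$ is the coordinate-wise restriction of some $(g_1,\dots,g_i)\in A^{(i)}$; (c) there is a $*$-isomorphism $\Gamma\colon B\to D$ with $\Gamma(\rho(a))_i=a_i|_{X_i'}$ for all $a\in A$ and all $i$. 2. Let $\psi\colon A_1\to A_2$ be a diagonal map of DSH algebras and let $\rho_k\colon A_k\to B_k$ ($k=1,2$) be surjective $*$-homomorphisms onto $\mathrm C^*$-algebras with $\psi(\ker\rho_1)\subseteq\ker\rho_2$. For $k=1,2$, let $D_k$ be a DSH algebra over the spaces attached to $\rho_k$ and $\Gamma_k\colon B_k\to D_k$ a $*$-isomorphism given by restriction as in (c). Then there is a diagonal map $\psi'\colon D_1\to D_2$ with $\psi'\circ\Gamma_1\circ\rho_1=\Gamma_2\circ\rho_2\circ\psi$. It is injective if $\psi^{-1}(\ker\rho_2)\subseteq\ker\rho_1$. 3. Let $A_1\xrightarrow{\psi_1}A_2\xrightarrow{\psi_2}\cdots\to L=\varinjlim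 A_n$ be an inductive limit (in the category of $\mathrm C^*$-algebras) of DSH algebras with diagonal maps, with canonical maps $\mu_n\colon A_n\to L$. Then there are DSH algebras $D_n$, injective diagonal maps $\psi_n'\colon D_n\to D_{n+1}$, and maps $\mu_n'\colon D_n\to L$ that make $L$ the inductive limit of $D_1\xrightarrow{\psi_1'}D_2\xrightarrow{\psi_2'}\cdots$. Moreover, the $D_n$ can be chosen of the same length and with the same matrix sizes as $A_n$, over closed subsets $Z_i^n$ of the base spaces of $A_n$ and their intersections with the given closed subsets, with pullback maps related to those of $A_n$ as in (a), and so that coordinate-wise restriction defines surjective $*$-homomorphisms $\kappa_n\colon A_n\to D_n$ with $\ker\kappa_n=\ker\mu_n$, $\psi_n'\circ\kappa_n=\kappa_{n+1}\circ\psi_n$ and $\mu_n'\circ\kappa_n=\mu_n$. -/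

import Mathlib

universe u v w w'

open scoped Matrix.Norms.L2Operator

noncomputable section

/-! ### Block-diagonal matrices -/

/-- `diag(N₁, …, N_t)`, the block-diagonal matrix with the square blocks `N₁, …, N_t` placed in this
order down the diagonal. -/
def blockDiag {t : ℕ} {m : Fin t → ℕ} (N : ∀ s, Matrix (Fin (m s)) (Fin (m s)) ℂ) :
    Matrix (Fin (∑ s, m s)) (Fin (∑ s, m s)) ℂ :=
  Matrix.reindex finSigmaFinEquiv finSigmaFinEquiv (Matrix.blockDiagonal' N)

/-- `M = diag(N₁, …, N_t)`; in particular the sizes of the blocks add up to the size of `M`. -/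
def IsBlockDiag {n t : ℕ} {m : Fin t → ℕ} (M : Matrix (Fin n) (Fin n) ℂ)
    (N : ∀ s, Matrix (Fin (m s)) (Fin (m s)) ℂ) : Prop :=
  ∃ h : ∑ s, m s = n, M = Matrix.reindex (finCongr h) (finCongr h) (blockDiag N)

/-! ### Recursive subhomogeneous algebras -/

/-- The spaces and matrix sizes of a decomposition of length `l`: compact metric spaces
`X₁, …, X_l`, closed subsets `Y_i ⊆ X_i` with `Y₁ = ∅`, and positive integers `n₁, …, n_l`.
The index `i : Fin l` stands for the position `i + 1`. The spaces may be empty. -/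
structure BaseSystem (l : ℕ) where
  length_pos : 0 < l
  X : Fin l → Type u
  [metric : ∀ i, MetricSpace (X i)]
  [compact : ∀ i, CompactSpace (X i)]
  Y : ∀ i, Set (X i)
  isClosed_Y : ∀ i, IsClosed (Y i)
  Y_first : ∀ i : Fin l, (i : ℕ) = 0 → Y i = ∅
  n : Fin l → ℕ
  n_pos : ∀ i, 0 < n i

attribute [instance] BaseSystem.metric BaseSystem.compact

namespace BaseSystem

variable {l : ℕ} (S : BaseSystem.{u} l)

/-- The matrix algebra `M_{n_i}`. -/
abbrev Mat (i : Fin l) : Type := Matrix (Fin (S.n i)) (Fin (S.n i)) ℂ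

/-- The direct sum of the first `k` algebras `C(X_j, M_{n_j})`. -/
abbrev Coord (k : Fin (l + 1)) : Type u :=
  ∀ j : {j : Fin l // j.castSucc < k}, C(S.X j, S.Mat j)

instance (i : Fin l) : CompactSpace (S.Y i) :=
  isCompact_iff_compactSpace.mp (S.isClosed_Y i).isCompact

/-- `(f₁, …, f_{i+1}) ↦ (f₁, …, f_i)`. -/
def trunc (i : Fin l) (f : S.Coord i.succ) : S.Coord i.castSucc :=
  fun j => f ⟨j, j.2.trans i.castSucc_lt_succ⟩

/-- `(f₁, …, f_{i+1}) ↦ f_{i+1}`. -/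
def top (i : Fin l) (f : S.Coord i.succ) : C(S.X i, S.Mat i) :=
  f ⟨i, i.castSucc_lt_succ⟩

/-- The base system obtained by shrinking every `X_i` to a closed subset `Z_i` and every `Y_i` to
`Z_i ∩ Y_i`, the sizes `n_i` being kept. -/
def restrict (Z : ∀ i, TopologicalSpace.Closeds (S.X i)) : BaseSystem.{u} l where
  length_pos := S.length_pos
  X i := Z i
  metric i := inferInstanceAs (MetricSpace (Z i : Set (S.X i)))
  compact i := isCompact_iff_compactSpace.mp (Z i).isClosed.isCompact
  Y i := Subtype.val ⁻¹' S.Y i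
  isClosed_Y i := (S.isClosed_Y i).preimage continuous_subtype_val
  Y_first i hi := by rw [S.Y_first i hi, Set.preimage_empty]
  n := S.n
  n_pos := S.n_pos

/-- Coordinate-wise restriction of functions, `(f_j)_j ↦ (f_j|_{Z_j})_j`. -/
def restrictCoord (Z : ∀ i, TopologicalSpace.Closeds (S.X i)) {k : Fin (l + 1)} (f : S.Coord k) :
    (S.restrict Z).Coord k :=
  fun j => (f j).restrict (Z j : Set (S.X j))

end BaseSystem

/-- A recursive subhomogeneous algebra with its decomposition over the base system `S`. The algebra
`stage k` is `A^{(k)} ⊆ ⊕_{j ≤ k} C(X_j, M_{n_j})`; the pullback map into `C(Y_i, M_{n_i})` is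
defined on the algebra built from the coordinates strictly before `i`. By convention `A^{(0)}` is
the zero algebra (the empty direct sum), so that, as `Y₁ = ∅`, the first of the pullback conditions
says `A^{(1)} = C(X₁, M_{n₁})`. -/
structure RSHAlgebra {l : ℕ} (S : BaseSystem.{u} l) where
  stage : ∀ k : Fin (l + 1), StarSubalgebra ℂ (S.Coord k)
  φ : ∀ i : Fin l, stage i.castSucc →⋆ₐ[ℂ] C(S.Y i, S.Mat i)
  mem_stage_succ : ∀ (i : Fin l) (f : S.Coord i.succ), f ∈ stage i.succ ↔
    ∃ h : S.trunc i f ∈ stage i.castSucc, φ i ⟨S.trunc i f, h⟩ = (S.top i f).restrict (S.Y i)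

namespace RSHAlgebra

variable {l : ℕ} {S : BaseSystem.{u} l} (A : RSHAlgebra S)

theorem isClosed_stage (k : Fin (l + 1)) : IsClosed (A.stage k : Set (S.Coord k)) := by
  induction k using Fin.induction with
  | zero =>
    have : IsEmpty {j : Fin l // j.castSucc < 0} := ⟨fun j => absurd j.2 (Fin.not_lt_zero _)⟩
    exact (Set.subsingleton_of_subsingleton).isClosed
  | succ i ih =>
    have : IsClosed (A.stage i.castSucc : Set (S.Coord i.castSucc)) := ih
    have hφ : Continuous (A.φ i) := by
      open scoped CStarAlgebra in
      exact map_continuous (A.φ i)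
    have htr : Continuous (S.trunc i) := continuous_pi fun j => continuous_apply _
    have htop : Continuous fun f => (S.top i f).restrict (S.Y i) :=
      (ContinuousMap.continuous_restrict _).comp (continuous_apply _)
    refine IsSeqClosed.isClosed fun f g hf hfg => ?_
    simp only [SetLike.mem_coe, A.mem_stage_succ] at hf ⊢
    choose h hh using hf
    have h1 := (htr.tendsto g).comp hfg
    have hm : S.trunc i g ∈ A.stage i.castSucc := ih.mem_of_tendsto h1 (.of_forall h)
    refine ⟨hm, ?_⟩
    have h2 : Filter.Tendsto (fun k => (⟨S.trunc i (f k), h k⟩ : A.stage i.castSucc)) Filter.atTop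
        (nhds ⟨S.trunc i g, hm⟩) := tendsto_subtype_rng.mpr h1
    have h3 := (hφ.tendsto _).comp h2
    have h4 := (htop.tendsto g).comp hfg
    refine tendsto_nhds_unique h3 (h4.congr fun k => ?_)
    exact (hh k).symm

/-- The algebra `A = A^{(l)}` itself. -/
def alg : Type u := A.stage (Fin.last l)

/-- `A` is a C⋆-algebra, as a closed ⋆-subalgebra of `⊕ C(X_j, M_{n_j})`. -/
instance : CStarAlgebra A.alg :=
  haveI : IsClosed (A.stage (Fin.last l) : Set (S.Coord (Fin.last l))) := A.isClosed_stage _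
  StarSubalgebra.cstarAlgebra (A.stage (Fin.last l))

instance : NonUnitalCStarAlgebra A.alg := inferInstance

variable {A} in
/-- An element of `A` as a tuple `(f₁, …, f_l)`. -/
def tuple (f : A.alg) : S.Coord (Fin.last l) := Subtype.val f

variable {A} in
/-- The coordinate `f_i ∈ C(X_i, M_{n_i})` of `f ∈ A`. -/
def coord (f : A.alg) (i : Fin l) : C(S.X i, S.Mat i) := tuple f ⟨i, i.castSucc_lt_last⟩

/-- The evaluation `ev_x : A → M_{n_i}`, `f ↦ f_i(x)`, as a representation on `ℂ^{n_i}`. -/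
def ev (i : Fin l) (x : S.X i) :
    A.alg →⋆ₙₐ[ℂ] (EuclideanSpace ℂ (Fin (S.n i)) →L[ℂ] EuclideanSpace ℂ (Fin (S.n i))) where
  toFun f := Matrix.toEuclideanCLM (𝕜 := ℂ) (coord f i x)
  map_smul' c f := map_smul (Matrix.toEuclideanCLM (𝕜 := ℂ)) c (coord f i x)
  map_zero' := map_zero (Matrix.toEuclideanCLM (𝕜 := ℂ))
  map_add' f g := map_add (Matrix.toEuclideanCLM (𝕜 := ℂ)) (coord f i x) (coord g i x)
  map_mul' f g := map_mul (Matrix.toEuclideanCLM (𝕜 := ℂ)) (coord f i x) (coord g i x)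
  map_star' f := map_star (Matrix.toEuclideanCLM (𝕜 := ℂ)) (coord f i x)

/-- The point `y ∈ Y_i` decomposes into the points `p₁, …, p_t`: each `p_s` lies in `X_j \ Y_j` for
some `j < i`, and the pullback map satisfies `φ(f)(y) = diag(f(p₁), …, f(p_t))` for all `f` in the
algebra built from the coordinates before `i`. -/
def DecomposesInto (i : Fin l) (y : S.Y i) {t : ℕ}
    (p : Fin t → Σ j : {j : Fin l // j.castSucc < i.castSucc}, S.X j) : Prop :=
  (∀ s, (p s).2 ∉ S.Y (p s).1) ∧
    ∀ f : A.stage i.castSucc, IsBlockDiag (A.φ i f y) fun s => f.1 (p s).1 (p s).2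

end RSHAlgebra

/-- A diagonal subhomogeneous (DSH) algebra over the base system `S`. -/
structure DSHAlgebra {l : ℕ} (S : BaseSystem.{u} l) extends RSHAlgebra S where
  exists_decomposition : ∀ (i : Fin l) (y : S.Y i),
    ∃ (t : ℕ) (p : Fin t → Σ j : {j : Fin l // j.castSucc < i.castSucc}, S.X j),
      toRSHAlgebra.DecomposesInto i y p

/-- A ⋆-homomorphism `ψ : A₁ → A₂` between DSH algebras is diagonal if for every point `x` of a base
space of `A₂` there are points `p₁, …, p_t` of the base spaces of `A₁` such that
`ψ(f)_i(x) = diag(f(p₁), …, f(p_t))` for all `f ∈ A₁`. -/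
def IsDiagonalMap {l₁ l₂ : ℕ} {S₁ : BaseSystem.{u} l₁} {S₂ : BaseSystem.{v} l₂}
    {A₁ : DSHAlgebra S₁} {A₂ : DSHAlgebra S₂} (ψ : A₁.alg →⋆ₙₐ[ℂ] A₂.alg) : Prop :=
  ∀ (i : Fin l₂) (x : S₂.X i), ∃ (t : ℕ) (p : Fin t → Σ j, S₁.X j),
    ∀ f : A₁.alg, IsBlockDiag (RSHAlgebra.coord (ψ f) i x)
      fun s => RSHAlgebra.coord f (p s).1 (p s).2

/-! ### Representations and quotients -/

/-- A representation of a C⋆-algebra on a Hilbert space is irreducible if it is non-zero and its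
only closed invariant subspaces are the trivial ones. -/
def IsIrreducibleRep {B : Type v} [NonUnitalCStarAlgebra B] {H : Type w} [NormedAddCommGroup H]
    [InnerProductSpace ℂ H] [CompleteSpace H] (π : B →⋆ₙₐ[ℂ] (H →L[ℂ] H)) : Prop :=
  π ≠ 0 ∧ ∀ K : Submodule ℂ H, IsClosed (K : Set H) → (∀ b, ∀ ξ ∈ K, π b ξ ∈ K) → K = ⊥ ∨ K = ⊤

/-- Unitary equivalence of representations. -/
def UnitarilyEquivalent {B : Type v} [NonUnitalCStarAlgebra B]
    {H : Type w} [NormedAddCommGroup H] [InnerProductSpace ℂ H] [CompleteSpace H]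
    {K : Type w'} [NormedAddCommGroup K] [InnerProductSpace ℂ K] [CompleteSpace K]
    (π : B →⋆ₙₐ[ℂ] (H →L[ℂ] H)) (σ : B →⋆ₙₐ[ℂ] (K →L[ℂ] K)) : Prop :=
  ∃ U : H ≃ₗᵢ[ℂ] K, ∀ b ξ, U (π b ξ) = σ b (U ξ)

namespace DSHAlgebra

variable {l : ℕ} {S : BaseSystem.{u} l} (A : DSHAlgebra S) {B : Type v} [NonUnitalCStarAlgebra B]

/-- `X_i ∩ ρ̂(B̂)`: the points `x ∈ X_i \ Y_i` such that the class of `ev_x` is the class of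
`π ∘ ρ` for an irreducible representation `π` of `B`. Such a `π` acts on a space of dimension
`n_i`, so that the universe of the Hilbert spaces does not matter. -/
def spectrumPoints (ρ : A.alg →⋆ₙₐ[ℂ] B) (i : Fin l) : Set (S.X i) :=
  {x | x ∉ S.Y i ∧ ∃ (H : Type) (_ : NormedAddCommGroup H) (_ : InnerProductSpace ℂ H)
    (_ : CompleteSpace H) (π : B →⋆ₙₐ[ℂ] (H →L[ℂ] H)),
      IsIrreducibleRep π ∧ UnitarilyEquivalent (π.comp ρ) (A.ev i x)}

/-- `X_i'`, the closure of `X_i ∩ ρ̂(B̂)` in `X_i`. -/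
def quotientSpace (ρ : A.alg →⋆ₙₐ[ℂ] B) (i : Fin l) : TopologicalSpace.Closeds (S.X i) :=
  TopologicalSpace.Closeds.closure (A.spectrumPoints ρ i)

/-- The base system `X_i'`, `Y_i' = X_i' ∩ Y_i`, `n_i` attached to a quotient map `ρ : A → B`. -/
abbrev quotientBase (ρ : A.alg →⋆ₙₐ[ℂ] B) : BaseSystem.{u} l := S.restrict (A.quotientSpace ρ)

/-- The pullback maps `τ` of the DSH algebra `D` over closed subsets `Z_i` of the base spaces of `A`
are those of `A`: whenever `y ∈ Z_i ∩ Y_i` decomposes into `p₁, …, p_t` in `A`, the points `p_s` lie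
in the sets `Z_j`, and `τ(f)(y) = diag(f(p₁), …, f(p_t))`. -/
def HasRestrictedPullbacks (Z : ∀ i, TopologicalSpace.Closeds (S.X i))
    (D : DSHAlgebra (S.restrict Z)) : Prop :=
  ∀ (i : Fin l) (y : (S.restrict Z).Y i) (t : ℕ)
    (p : Fin t → Σ j : {j : Fin l // j.castSucc < i.castSucc}, S.X j),
    A.DecomposesInto i ⟨y.1.1, y.2⟩ p →
      ∃ hp : ∀ s, (p s).2 ∈ Z (p s).1, ∀ f : D.stage i.castSucc,
        IsBlockDiag (D.φ i f y) fun s => f.1 (p s).1 ⟨(p s).2, hp s⟩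

/-- `Γ : B → D` is the canonical isomorphism: `Γ(ρ(a))_i = a_i|_{Z_i}` for all `a ∈ A`. -/
def IsCanonicalIso (ρ : A.alg →⋆ₙₐ[ℂ] B) (Z : ∀ i, TopologicalSpace.Closeds (S.X i))
    (D : DSHAlgebra (S.restrict Z)) (Γ : B ≃⋆ₐ[ℂ] D.alg) : Prop :=
  ∀ a : A.alg, RSHAlgebra.tuple (Γ (ρ a)) = S.restrictCoord Z (RSHAlgebra.tuple a)

end DSHAlgebra

/-! ### Inductive limits -/

/-- `L`, with the maps `μ n : A n → L`, is the inductive limit in the category of C⋆-algebras of the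
sequence `A 0 → A 1 → ⋯` with bonding maps `ψ n`. -/
structure IsInductiveLimit (A : ℕ → Type u) [∀ n, NonUnitalCStarAlgebra (A n)]
    (ψ : ∀ n, A n →⋆ₙₐ[ℂ] A (n + 1)) (L : Type v) [NonUnitalCStarAlgebra L]
    (μ : ∀ n, A n →⋆ₙₐ[ℂ] L) : Prop where
  compatible : ∀ n, (μ (n + 1)).comp (ψ n) = μ n
  universal : ∀ (C : Type (max u v)) [NonUnitalCStarAlgebra C] (ν : ∀ n, A n →⋆ₙₐ[ℂ] C),
    (∀ n, (ν (n + 1)).comp (ψ n) = ν n) →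
      ∃! χ : L →⋆ₙₐ[ℂ] C, ∀ n, χ.comp (μ n) = ν n

end

/-! ### Block-diagonal matrices -/

/-! The kernel of a ⋆-homomorphism `ρ` is determined by its hull, the points off the `Y_i` at which
it vanishes (`RSHAlgebra.map_eq_zero_iff`). An element vanishing on the hull is approximated by
kernel elements one coordinate at a time. Once the coordinates before `i` are approximated,
contractivity of the pullback map makes the error small on `Y_i`. Wherever the error is still large,
the point is off `Y_i` and off the hull, so `ker ρ` evaluates onto the whole (simple) matrix algebra
there, and a partition of unity patches these local corrections together.

A block-diagonal matrix vanishes only if all its blocks do. Hence the points into which a point of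
`Y_i` in the closed hull decomposes lie in the hull again (`IsHullFamily.isInvariant`). Over such an
invariant family of closed sets the restricted functions form a DSH algebra
(`IsInvariant.restrict`): the pullbacks only see restricted values, and Tietze extension lifts
compatible tuples. Restriction has kernel `ker ρ`, which identifies the quotient.

The same vanishing argument, after refining to points off the `Y_i`, makes diagonal maps descend
(`IsDiagonalMap.exists_descent`). For an inductive limit this is applied to the kernels of the
canonical maps, where the induced maps become injective. -/

theorem finSigmaFinEquiv_lt_of_lex {t : ℕ} {m : Fin t → ℕ} {x y : (s : Fin t) × Fin (m s)}
    (h : Sigma.Lex (· < ·) (fun _ => (· < ·)) x y) :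
    finSigmaFinEquiv x < finSigmaFinEquiv y := by
  rw [Fin.lt_def, finSigmaFinEquiv_apply, finSigmaFinEquiv_apply]
  cases h with
  | @left i j a b hij =>
    have hle : (i : ℕ) + 1 ≤ j := hij
    have h1 : ∑ s : Fin ((i : ℕ) + 1), m (Fin.castLE (hle.trans j.2.le) s) ≤
        ∑ s : Fin j, m (Fin.castLE j.2.le s) := by
      refine le_of_eq_of_le (Finset.sum_map Finset.univ (Fin.castLEEmb hle)
        fun s : Fin j => m (Fin.castLE j.2.le s)).symm ?_
      exact Finset.sum_le_sum_of_subset (Finset.subset_univ _)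
    rw [Fin.sum_univ_castSucc] at h1
    have h2 : (a : ℕ) < m (Fin.castLE (hle.trans j.2.le) (Fin.last i)) := a.2
    have h3 : ∑ s : Fin i, m (Fin.castLE (hle.trans j.2.le) s.castSucc) =
      ∑ s : Fin i, m (Fin.castLE i.2.le s) := rfl
    dsimp only
    omega
  | right a b hab => simpa using hab

/-- Two such bijections differ by an order automorphism of `Fin n`, and a finite chain has no
nontrivial one. -/
theorem equiv_eq_of_lex {n t : ℕ} {m : Fin t → ℕ} {e e' : ((s : Fin t) × Fin (m s)) ≃ Fin n}
    (he : ∀ x y, Sigma.Lex (· < ·) (fun _ => (· < ·)) x y → e x < e y)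
    (he' : ∀ x y, Sigma.Lex (· < ·) (fun _ => (· < ·)) x y → e' x < e' y) : e = e' := by
  have key : ∀ f : ((s : Fin t) × Fin (m s)) ≃ Fin n,
      (∀ x y, Sigma.Lex (· < ·) (fun _ => (· < ·)) x y → f x < f y) →
      ∀ x y, Sigma.Lex (· < ·) (fun _ => (· < ·)) x y ↔ f x < f y := by
    intro f hf x y
    refine ⟨hf x y, fun h => ?_⟩
    rcases trichotomous_of (Sigma.Lex (· < ·) (fun _ => (· < ·))) x y with h' | h' | h'
    · exact h'
    · exact absurd h (by simp [h'])
    · exact absurd h (hf y x h').asymm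
  have : StrictMono (e.symm.trans e') := by
    intro a b hab
    refine he' _ _ ((key e he _ _).2 ?_)
    simpa using hab
  let o : Fin n ≃o Fin n := this.orderIsoOfRightInverse _ _ (e.symm.trans e').apply_symm_apply
  have ho : o = OrderIso.refl _ := Subsingleton.elim _ _
  ext x : 1
  have := congrArg (fun f : Fin n ≃o Fin n => f (e x)) ho
  simpa [o] using this.symm

/-- Trades the equality of sizes, and the casts it causes, for an order-preserving indexing, which
composes well when blocks are nested. -/
theorem isBlockDiag_iff {n t : ℕ} {m : Fin t → ℕ} {M : Matrix (Fin n) (Fin n) ℂ}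
    {N : ∀ s, Matrix (Fin (m s)) (Fin (m s)) ℂ} :
    IsBlockDiag M N ↔ ∃ e : ((s : Fin t) × Fin (m s)) ≃ Fin n,
      (∀ x y, Sigma.Lex (· < ·) (fun _ => (· < ·)) x y → e x < e y) ∧
        M = Matrix.reindex e e (Matrix.blockDiagonal' N) := by
  constructor
  · rintro ⟨h, rfl⟩
    refine ⟨finSigmaFinEquiv.trans (finCongr h), fun x y hxy => ?_, rfl⟩
    simpa [Fin.lt_def] using finSigmaFinEquiv_lt_of_lex hxy
  · rintro ⟨e, he, rfl⟩
    have h : ∑ s, m s = n := by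
      simpa using Fintype.card_congr e
    refine ⟨h, ?_⟩
    have : e = finSigmaFinEquiv.trans (finCongr h) := equiv_eq_of_lex he fun x y hxy => by
      simpa [Fin.lt_def] using finSigmaFinEquiv_lt_of_lex hxy
    rw [this]
    rfl

/-- A block-diagonal matrix whose blocks are block-diagonal is block-diagonal, with an ordering of
the inner blocks that depends only on their numbers. -/
theorem IsBlockDiag.flatten {n t : ℕ} {m : Fin t → ℕ} {M : Matrix (Fin n) (Fin n) ℂ}
    {N : ∀ s, Matrix (Fin (m s)) (Fin (m s)) ℂ} (hM : IsBlockDiag M N)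
    {r : Fin t → ℕ} {k : ∀ s, Fin (r s) → ℕ}
    {P : ∀ s u, Matrix (Fin (k s u)) (Fin (k s u)) ℂ} (hN : ∀ s, IsBlockDiag (N s) (P s)) :
    IsBlockDiag M fun q : Fin (∑ s, r s) =>
      P (finSigmaFinEquiv.symm q).1 (finSigmaFinEquiv.symm q).2 := by
  rw [isBlockDiag_iff] at hM
  simp only [isBlockDiag_iff] at hN
  obtain ⟨e, he, rfl⟩ := hM
  choose e' he' hN using hN
  -- `d` reassociates the flattened index and then applies the inner indexing `e'`; composed with
  -- `e` it preserves the lexicographic order.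
  let d : ((q : Fin (∑ s, r s)) × Fin (k (finSigmaFinEquiv.symm q).1 (finSigmaFinEquiv.symm q).2))
      ≃ (s : Fin t) × Fin (m s) :=
    (Equiv.sigmaCongrLeft (β := fun p : (s : Fin t) × Fin (r s) => Fin (k p.1 p.2))
      finSigmaFinEquiv.symm).trans
      ((Equiv.sigmaAssoc fun s u => Fin (k s u)).trans (Equiv.sigmaCongrRight e'))
  have hd : ∀ q a, d ⟨q, a⟩ = ⟨(finSigmaFinEquiv.symm q).1, e' _ ⟨_, a⟩⟩ := fun q a => rfl
  have hlex : ∀ q q' : Fin (∑ s, r s), q < q' → Sigma.Lex (· < ·) (fun _ => (· < ·))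
      (finSigmaFinEquiv.symm q) (finSigmaFinEquiv.symm q') := by
    intro q q' h
    rcases trichotomous_of (Sigma.Lex (· < ·) (fun _ => (· < ·)))
      (finSigmaFinEquiv.symm q) (finSigmaFinEquiv.symm q') with h' | h' | h'
    · exact h'
    · exact absurd h (by simp [finSigmaFinEquiv.symm.injective h'])
    · exact absurd h (by simpa using (finSigmaFinEquiv_lt_of_lex h').le)
  rw [isBlockDiag_iff]
  refine ⟨d.trans e, ?_, ?_⟩
  · rintro ⟨q, a⟩ ⟨q', a'⟩ h
    refine he _ _ ?_
    rw [hd, hd]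
    cases h with
    | left _ _ hq =>
      have := hlex q q' hq
      revert a a'
      generalize finSigmaFinEquiv.symm q = p at this ⊢
      generalize finSigmaFinEquiv.symm q' = p' at this ⊢
      intro a a'
      cases this with
      | left _ _ h1 => exact .left _ _ h1
      | right _ _ h1 => exact .right _ _ (he' _ _ _ (.left _ _ h1))
    | right _ _ hq => exact .right _ _ (he' _ _ _ (.right _ _ hq))
  · ext a b
    obtain ⟨⟨q, x⟩, rfl⟩ := (d.trans e).surjective a
    obtain ⟨⟨q', x'⟩, rfl⟩ := (d.trans e).surjective b
    simp only [Matrix.reindex_apply, Matrix.submatrix_apply, Equiv.symm_apply_apply]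
    simp only [Equiv.trans_apply, Equiv.symm_apply_apply]
    rw [hd, hd]
    by_cases hq : q = q'
    · subst hq
      simp [hN]
    · have hp : finSigmaFinEquiv.symm q ≠ finSigmaFinEquiv.symm q' := by simpa using hq
      rw [Matrix.blockDiagonal'_apply_ne _ _ _ hq]
      revert x x'
      generalize finSigmaFinEquiv.symm q = p at hp ⊢
      generalize finSigmaFinEquiv.symm q' = p' at hp ⊢
      obtain ⟨s, c⟩ := p
      obtain ⟨s', c'⟩ := p'
      intro x x'
      by_cases hs : s = s'
      · subst hs
        have hc : c ≠ c' := fun h => hp (by rw [h])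
        simp [hN, Matrix.blockDiagonal'_apply_ne _ _ _ hc]
      · rw [Matrix.blockDiagonal'_apply_ne _ _ _ hs]

theorem IsBlockDiag.eq_zero_iff {n t : ℕ} {m : Fin t → ℕ} {M : Matrix (Fin n) (Fin n) ℂ}
    {N : ∀ s, Matrix (Fin (m s)) (Fin (m s)) ℂ} (hM : IsBlockDiag M N) :
    M = 0 ↔ ∀ s, N s = 0 := by
  obtain ⟨h, rfl⟩ := hM
  rw [blockDiag, ← Matrix.coe_reindexLinearEquiv ℂ ℂ, ← Matrix.coe_reindexLinearEquiv ℂ ℂ,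
    LinearEquiv.map_eq_zero_iff, LinearEquiv.map_eq_zero_iff, ← Matrix.blockDiagonal'_zero,
    Matrix.blockDiagonal'_inj, funext_iff]
  rfl

/-! ### Continuous extension of matrix-valued functions. -/

instance Matrix.instTietzeExtensionComplex {m n : Type*} : TietzeExtension.{u} (Matrix m n ℂ) :=
  inferInstanceAs (TietzeExtension (m → n → ℂ))

/-- Two continuous functions on closed sets that agree on the intersection of these sets have a
common continuous extension. -/
theorem ContinuousMap.exists_restrict_eq_and_restrict_eq {X : Type u} {E : Type v}
    [TopologicalSpace X] [NormalSpace X] [TopologicalSpace E] [TietzeExtension.{u} E] {s t : Set X}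
    (hs : IsClosed s) (ht : IsClosed t) (f : C(s, E)) (g : C(t, E))
    (h : ∀ x (hxs : x ∈ s) (hxt : x ∈ t), f ⟨x, hxs⟩ = g ⟨x, hxt⟩) :
    ∃ F : C(X, E), F.restrict s = f ∧ F.restrict t = g := by
  classical
  obtain ⟨F₁, rfl⟩ := f.exists_restrict_eq hs
  obtain ⟨F₂, rfl⟩ := g.exists_restrict_eq ht
  let G : X → E := s.piecewise F₁ F₂
  have hGs : Set.EqOn G F₁ s := fun x hx => s.piecewise_eq_of_mem _ _ hx
  have hGt : Set.EqOn G F₂ t := fun x hx => by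
    by_cases hxs : x ∈ s
    · exact (hGs hxs).trans (h x hxs hx)
    · exact s.piecewise_eq_of_notMem _ _ hxs
  have hG : ContinuousOn G (s ∪ t) :=
    (F₁.continuous.continuousOn.congr hGs).union_of_isClosed
      (F₂.continuous.continuousOn.congr hGt) hs ht
  obtain ⟨F, hF⟩ := ContinuousMap.exists_restrict_eq (hs.union ht)
    (⟨(s ∪ t).domRestrict G, hG.domRestrict⟩ : C(↥(s ∪ t), E))
  have hF' : ∀ x ∈ s ∪ t, F x = G x := fun x hx => DFunLike.congr_fun hF ⟨x, hx⟩
  refine ⟨F, ?_, ?_⟩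
  · ext1 x
    exact (hF' x (.inl x.2)).trans (hGs x.2)
  · ext1 x
    exact (hF' x (.inr x.2)).trans (hGt x.2)

theorem BaseSystem.exists_trunc_eq_top_eq {l : ℕ} (S : BaseSystem.{u} l) (i : Fin l)
    (g : S.Coord i.castSucc) (F : C(S.X i, S.Mat i)) :
    ∃ G : S.Coord i.succ, S.trunc i G = g ∧ S.top i G = F := by
  -- An index not below `i` equals `i`; there `Pi.single` returns `F` without an explicit cast.
  refine ⟨fun j => if h : j.1.castSucc < i.castSucc then g ⟨j, h⟩ else
    Pi.single (M := fun j => C(S.X j, S.Mat j)) i F j.1, ?_, ?_⟩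
  · funext j
    exact dif_pos j.2
  · simp [BaseSystem.top]

/-! ### Elements with prescribed coordinates. -/

namespace RSHAlgebra

variable {l : ℕ} {S : BaseSystem.{u} l} (A : RSHAlgebra S)

variable {A} in
@[simp] theorem coord_sub (f g : A.alg) (i : Fin l) : coord (f - g) i = coord f i - coord g i := rfl

variable {A} in
theorem norm_le_of_coord {f : A.alg} {ε : ℝ} (hε : 0 ≤ ε) (h : ∀ i x, ‖coord f i x‖ ≤ ε) :
    ‖f‖ ≤ ε :=
  (pi_norm_le_iff_of_nonneg hε).2 fun j => (ContinuousMap.norm_le _ hε).2 (h j.1)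

/-- The coordinate `f_i(x)` as a linear map. -/
noncomputable def coordₗ (i : Fin l) (x : S.X i) : A.alg →ₗ[ℂ] S.Mat i where
  toFun f := coord f i x
  map_add' _ _ := rfl
  map_smul' _ _ := rfl

theorem trunc_mem {f : S.Coord (Fin.last l)} (hf : f ∈ A.stage (Fin.last l)) (k : Fin (l + 1)) :
    (fun j => f ⟨j.1, j.1.castSucc_lt_last⟩ : S.Coord k) ∈ A.stage k := by
  induction k using Fin.reverseInduction with
  | last => exact hf
  | cast i ih => exact ((A.mem_stage_succ i _).1 ih).1

/-- The truncation `A → A^{(k)}`. -/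
def truncate (k : Fin (l + 1)) (f : A.alg) : A.stage k := ⟨_, A.trunc_mem f.2 k⟩

theorem truncate_apply (k : Fin (l + 1)) (f : A.alg) (j : {j : Fin l // j.castSucc < k}) :
    (A.truncate k f).1 j = coord f j.1 := rfl

theorem φ_truncate (f : A.alg) (i : Fin l) (y : S.Y i) :
    A.φ i (A.truncate i.castSucc f) y = coord f i y := by
  obtain ⟨_, h⟩ := (A.mem_stage_succ i _).1 (A.truncate i.succ f).2
  exact DFunLike.congr_fun h y

/-- The boundary values that the pullback map dictates on the closed set `Y_i` extend to `X_i` by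
Tietze, so a partial tuple can be continued one coordinate at a time. -/
theorem exists_coord_eq {k : Fin (l + 1)} (f : A.stage k) :
    ∃ g : A.alg, ∀ (j : Fin l) (hj : j.castSucc < k), coord g j = f.1 ⟨j, hj⟩ := by
  suffices H : ∀ k' : Fin (l + 1), k ≤ k' → ∃ g : A.stage k', ∀ (j : Fin l) (hj : j.castSucc < k)
      (hj' : j.castSucc < k'), g.1 ⟨j, hj'⟩ = f.1 ⟨j, hj⟩ by
    obtain ⟨g, hg⟩ := H (Fin.last l) (Fin.le_last _)
    exact ⟨g, fun j hj => hg j hj _⟩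
  intro k'
  induction k' using Fin.induction with
  | zero =>
    intro hk
    obtain rfl : k = 0 := Fin.le_zero_iff.1 hk
    exact ⟨f, fun _ _ _ => rfl⟩
  | succ i ih =>
    intro hk
    rcases hk.eq_or_lt with rfl | hk
    · exact ⟨f, fun _ _ _ => rfl⟩
    obtain ⟨g, hg⟩ := ih (Fin.le_castSucc_iff.2 hk)
    obtain ⟨F, hF⟩ := (A.φ i g).exists_restrict_eq (S.isClosed_Y i)
    obtain ⟨G, hGg, hGF⟩ := S.exists_trunc_eq_top_eq i g.1 F
    refine ⟨⟨G, (A.mem_stage_succ i G).2 ⟨hGg ▸ g.2, ?_⟩⟩, fun j hj hj' => ?_⟩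
    · rw [hGF, hF]
      congr 1
      exact Subtype.ext hGg
    · have hji := hj.trans_le (Fin.le_castSucc_iff.2 hk)
      exact (congrFun hGg ⟨j, hji⟩).trans (hg j hj hji)

/-- The tuple `(0, …, 0, F)` meets the pullback condition because both sides are zero on `Y_i`. The
later coordinates are whatever the extension produces. -/
theorem exists_coord_eq_of_restrict_eq_zero (i : Fin l) (F : C(S.X i, S.Mat i))
    (hF : ∀ y ∈ S.Y i, F y = 0) :
    ∃ g : A.alg, coord g i = F ∧ ∀ j < i, coord g j = 0 := by
  have hmem : (Pi.single ⟨i, i.castSucc_lt_succ⟩ F : S.Coord i.succ) ∈ A.stage i.succ := by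
    have h0 : S.trunc i (Pi.single ⟨i, i.castSucc_lt_succ⟩ F) = 0 := by
      funext j
      exact Pi.single_eq_of_ne (fun h => j.2.ne (by rw [Subtype.ext_iff.1 h])) _
    refine (A.mem_stage_succ i _).2 ⟨h0 ▸ zero_mem _, ?_⟩
    have : (⟨S.trunc i (Pi.single ⟨i, i.castSucc_lt_succ⟩ F), h0 ▸ zero_mem _⟩ :
      A.stage i.castSucc) = 0 := Subtype.ext h0
    rw [this, map_zero]
    ext1 y
    simp [BaseSystem.top, hF y y.2]
  obtain ⟨g, hg⟩ := A.exists_coord_eq ⟨_, hmem⟩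
  refine ⟨g, by simpa using hg i i.castSucc_lt_succ, fun j hj => ?_⟩
  rw [hg j (Fin.castSucc_lt_succ_iff.2 hj.le)]
  exact Pi.single_eq_of_ne (fun h => hj.ne (Subtype.ext_iff.1 h)) _

/-- A function may be prescribed as zero on `Y_i` and as `M` at `x`. Surjectivity of evaluation off
`Y_i` gives both the ideal dichotomy below and the irreducibility of `ev_x`. -/
theorem exists_coord_apply_eq {i : Fin l} {x : S.X i} (hx : x ∉ S.Y i) (M : S.Mat i) :
    ∃ g : A.alg, coord g i x = M := by
  obtain ⟨F, hF, hFx⟩ := ContinuousMap.exists_restrict_eq_and_restrict_eq (S.isClosed_Y i)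
    (isClosed_singleton (x := x)) (0 : C(S.Y i, S.Mat i)) (ContinuousMap.const _ M)
    (fun z hz hzx => absurd hz (by rwa [Set.mem_singleton_iff.1 hzx]))
  obtain ⟨g, hg, -⟩ := A.exists_coord_eq_of_restrict_eq_zero i F
    fun y hy => DFunLike.congr_fun hF ⟨y, hy⟩
  exact ⟨g, by rw [hg]; exact DFunLike.congr_fun hFx ⟨x, rfl⟩⟩

/-- Contractivity of ⋆-homomorphisms; it carries an estimate on the earlier coordinates over to
`Y_i`. -/
theorem norm_φ_apply_le (i : Fin l) (f : A.stage i.castSucc) {ε : ℝ} (hε : 0 ≤ ε)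
    (hf : ∀ j x, ‖f.1 j x‖ ≤ ε) (y : S.Y i) : ‖A.φ i f y‖ ≤ ε := by
  have : IsClosed (A.stage i.castSucc : Set (S.Coord i.castSucc)) := A.isClosed_stage _
  have h1 : ‖A.φ i f‖ ≤ ‖f‖ := NonUnitalStarAlgHom.norm_apply_le (A.φ i) f
  have h2 : ‖f‖ ≤ ε := (pi_norm_le_iff_of_nonneg hε).2 fun j => (ContinuousMap.norm_le _ hε).2 (hf j)
  exact ((A.φ i f).norm_coe_le_norm y).trans (h1.trans h2)

end RSHAlgebra

/-! ### Ideals and their zero sets -/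

namespace RSHAlgebra

variable {l : ℕ} {S : BaseSystem.{u} l} (A : RSHAlgebra S) {B : Type v} [NonUnitalCStarAlgebra B]

/-- The points of `X_i \ Y_i` at which all elements of `ker ρ` vanish. -/
def hull (ρ : A.alg →⋆ₙₐ[ℂ] B) (i : Fin l) : Set (S.X i) :=
  {x | x ∉ S.Y i ∧ ∀ f, ρ f = 0 → coord f i x = 0}

/-- Evaluation at `x` is onto, so it maps `ker ρ` to a two-sided ideal of a simple matrix algebra;
this ideal is nonzero because `x` is not in the hull. -/
theorem exists_ker_coord_apply_eq (ρ : A.alg →⋆ₙₐ[ℂ] B) {i : Fin l} {x : S.X i} (hx : x ∉ S.Y i)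
    (hxρ : x ∉ A.hull ρ i) (M : S.Mat i) : ∃ e : A.alg, ρ e = 0 ∧ coord e i x = M := by
  have : NeZero (S.n i) := ⟨(S.n_pos i).ne'⟩
  let I : TwoSidedIdeal (S.Mat i) := .mk' {M | ∃ e : A.alg, ρ e = 0 ∧ coord e i x = M}
    ⟨0, map_zero ρ, rfl⟩
    (by
      rintro _ _ ⟨e, he, rfl⟩ ⟨e', he', rfl⟩
      exact ⟨e + e', by rw [map_add, he, he', add_zero], rfl⟩)
    (by
      rintro _ ⟨e, he, rfl⟩
      exact ⟨-e, by rw [map_neg, he, neg_zero], rfl⟩)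
    (by
      rintro M _ ⟨e, he, rfl⟩
      obtain ⟨g, rfl⟩ := A.exists_coord_apply_eq hx M
      exact ⟨g * e, by rw [map_mul, he, mul_zero], rfl⟩)
    (by
      rintro _ M ⟨e, he, rfl⟩
      obtain ⟨g, rfl⟩ := A.exists_coord_apply_eq hx M
      exact ⟨e * g, by rw [map_mul, he, zero_mul], rfl⟩)
  have hI : ∀ N, N ∈ I ↔ ∃ e : A.alg, ρ e = 0 ∧ coord e i x = N := fun N =>
    TwoSidedIdeal.mem_mk' _ _ _ _ _ _ _
  rcases eq_bot_or_eq_top I with h | h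
  · refine absurd ⟨hx, fun f hf => ?_⟩ hxρ
    have : coord f i x ∈ I := (hI _).2 ⟨f, hf, rfl⟩
    rwa [h, TwoSidedIdeal.mem_bot] at this
  · exact (hI M).1 (h ▸ TwoSidedIdeal.mem_top _)

/-- The inductive correction: local kernel elements matching `h` are glued by scalar cutoffs that
vanish on `Y_i`, so the earlier coordinates stay untouched. -/
theorem exists_ker_norm_coord_sub_le (ρ : A.alg →⋆ₙₐ[ℂ] B) (i : Fin l) {h : A.alg}
    (h0 : ∀ x ∈ A.hull ρ i, coord h i x = 0) {δ : ℝ} (hδ : 0 < δ)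
    (hY : ∀ y ∈ S.Y i, ‖coord h i y‖ ≤ δ) :
    ∃ w : A.alg, ρ w = 0 ∧ (∀ j < i, coord w j = 0) ∧ ∀ x, ‖coord (h - w) i x‖ ≤ 3 * δ := by
  -- The threshold `2 * δ` exceeds the bound `δ` on `Y_i`, so `K` misses `Y_i` as well as the hull.
  let K : Set (S.X i) := {x | 2 * δ ≤ ‖coord h i x‖}
  have hK : IsClosed K := isClosed_le continuous_const (coord h i).continuous.norm
  have hKe : ∀ x : K, ∃ e : A.alg, ρ e = 0 ∧ coord e i x = coord h i x := by
    rintro ⟨x, hx : 2 * δ ≤ ‖coord h i x‖⟩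
    refine A.exists_ker_coord_apply_eq ρ (fun hxY => ?_) (fun hxρ => ?_) _
    · linarith [hY x hxY]
    · rw [h0 x hxρ, norm_zero] at hx
      linarith
  choose e heρ he using hKe
  let U : K → Set (S.X i) := fun x => {z | ‖coord h i z - coord (e x) i z‖ < δ} ∩ (S.Y i)ᶜ
  have hU : ∀ x, IsOpen (U x) := fun x =>
    (isOpen_lt ((coord h i).continuous.sub (coord (e x) i).continuous).norm continuous_const).inter
      (S.isClosed_Y i).isOpen_compl
  have hKU : K ⊆ ⋃ x, U x := by
    intro x hx
    refine Set.mem_iUnion.2 ⟨⟨x, hx⟩, ?_, fun hxY => ?_⟩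
    · simpa [he] using hδ
    · have : 2 * δ ≤ ‖coord h i x‖ := hx
      linarith [hY x hxY]
  obtain ⟨t, ht⟩ := hK.isCompact.elim_finite_subcover U hU hKU
  obtain ⟨b, hb⟩ := PartitionOfUnity.exists_isSubordinate hK (fun s : t => U s) (fun s => hU s)
    (by simpa [Set.iUnion_subtype] using ht)
  have hbU : ∀ s z, b s z ≠ 0 → z ∈ U s := fun s z hz => hb s (subset_tsupport _ hz)
  -- The cutoffs are supported off `Y_i`, hence come from elements of `A`; multiplying by them keeps
  -- the `e s` inside the kernel.
  have hc : ∀ s : t, ∃ c : A.alg, (∀ z, coord c i z = ((b s z : ℝ) : ℂ) • (1 : S.Mat i)) ∧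
      ∀ j < i, coord c j = 0 := by
    intro s
    let F : C(S.X i, S.Mat i) := ⟨fun z => ((b s z : ℝ) : ℂ) • (1 : S.Mat i), by fun_prop⟩
    obtain ⟨c, hc, hc'⟩ := A.exists_coord_eq_of_restrict_eq_zero i F fun y hy => by
      have : b s y = 0 := by
        by_contra hne
        exact (hbU s y hne).2 hy
      simp [F, this]
    exact ⟨c, fun z => by rw [hc]; rfl, hc'⟩
  choose c hc hc' using hc
  have hsum : ∀ j z, coord (∑ s : t, c s * e s) j z = ∑ s : t, coord (c s) j z * coord (e s) j z :=
    fun j z => map_sum (A.coordₗ j z) _ _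
  refine ⟨∑ s : t, c s * e s, ?_, fun j hj => ?_, fun z => ?_⟩
  · rw [map_sum]
    exact Finset.sum_eq_zero fun s _ => by rw [map_mul, heρ, mul_zero]
  · ext1 z
    rw [hsum]
    exact Finset.sum_eq_zero fun s _ => by rw [hc' s j hj, ContinuousMap.zero_apply, zero_mul]
  · have hσ : ∑ s : t, b s z ≤ 1 := by
      rw [← finsum_eq_sum_of_fintype]
      exact b.sum_le_one z
    have hσ0 : 0 ≤ ∑ s : t, b s z := Finset.sum_nonneg fun s _ => b.nonneg s z
    -- The first term is zero on `K`, where the cutoffs sum to 1, and at most `2 * δ` off `K`. The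
    -- second is at most `δ`, since `e s` is `δ`-close to `h` wherever `b s` is nonzero.
    have hsplit : coord (h - ∑ s : t, c s * e s) i z =
        ((1 - ∑ s : t, b s z : ℝ) : ℂ) • coord h i z +
          ∑ s : t, ((b s z : ℝ) : ℂ) • (coord h i z - coord (e s) i z) := by
      rw [coord_sub, ContinuousMap.sub_apply, hsum]
      simp only [hc, smul_mul_assoc, one_mul, smul_sub, Finset.sum_sub_distrib, ← Finset.sum_smul]
      push_cast
      rw [sub_smul, one_smul]
      abel
    have h1 : ‖((1 - ∑ s : t, b s z : ℝ) : ℂ) • coord h i z‖ ≤ 2 * δ := by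
      rw [norm_smul, Complex.norm_real, Real.norm_of_nonneg (by linarith)]
      by_cases hz : z ∈ K
      · have : ∑ s : t, b s z = 1 := by
          rw [← finsum_eq_sum_of_fintype]
          exact b.sum_eq_one hz
        rw [this, sub_self, zero_mul]
        positivity
      · have hz' : ‖coord h i z‖ < 2 * δ := not_le.1 hz
        nlinarith [norm_nonneg (coord h i z)]
    have h2 : ‖∑ s : t, ((b s z : ℝ) : ℂ) • (coord h i z - coord (e s) i z)‖ ≤
        ∑ s : t, b s z * δ := by
      refine norm_sum_le_of_le _ fun s _ => ?_
      rw [norm_smul, Complex.norm_real, Real.norm_of_nonneg (b.nonneg s z)]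
      by_cases hbs : b s z = 0
      · simp [hbs]
      · exact mul_le_mul_of_nonneg_left (hbU s z hbs).1.le (b.nonneg s z)
    rw [← Finset.sum_mul] at h2
    rw [hsplit]
    refine (norm_add_le _ _).trans ?_
    nlinarith

theorem exists_ker_norm_sub_le (ρ : A.alg →⋆ₙₐ[ℂ] B) {f : A.alg}
    (hf : ∀ i, ∀ x ∈ A.hull ρ i, coord f i x = 0) (k : Fin (l + 1)) :
    ∀ ε > 0, ∃ g : A.alg, ρ g = 0 ∧ ∀ j : Fin l, j.castSucc < k → ∀ x,
      ‖coord (f - g) j x‖ ≤ ε := by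
  induction k using Fin.induction with
  | zero => exact fun ε _ => ⟨0, map_zero ρ, fun j hj => absurd hj (Fin.not_lt_zero _)⟩
  | succ i ih =>
    intro ε hε
    -- Each correction loses a factor of 3.
    obtain ⟨g, hg, hfg⟩ := ih (ε / 3) (by positivity)
    obtain ⟨w, hw, hwj, hwi⟩ := A.exists_ker_norm_coord_sub_le ρ i (h := f - g) (δ := ε / 3)
      (fun x hx => by
        rw [coord_sub, ContinuousMap.sub_apply, hf i x hx, hx.2 g hg, sub_zero])
      (by positivity)
      (fun y hy => by
        rw [← A.φ_truncate (f - g) i ⟨y, hy⟩]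
        refine A.norm_φ_apply_le i _ (by positivity) (fun j x => ?_) _
        rw [truncate_apply]
        exact hfg j.1 j.2 x)
    refine ⟨g + w, by rw [map_add, hg, hw, add_zero], fun j hj x => ?_⟩
    rw [← sub_sub]
    rcases (Fin.castSucc_lt_succ_iff.1 hj).eq_or_lt with rfl | hji
    · exact (hwi x).trans_eq (by ring)
    · rw [coord_sub, hwj j hji, sub_zero]
      exact (hfg j (Fin.castSucc_lt_castSucc_iff.2 hji) x).trans (by linarith)

/-- A closed ideal of a recursive subhomogeneous algebra is determined by the points off the sets
`Y_i` at which it vanishes. -/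
theorem map_eq_zero_iff (ρ : A.alg →⋆ₙₐ[ℂ] B) (f : A.alg) :
    ρ f = 0 ↔ ∀ i, ∀ x ∈ A.hull ρ i, coord f i x = 0 := by
  refine ⟨fun h i x hx => hx.2 f h, fun h => norm_le_zero_iff.1 (le_of_forall_pos_le_add ?_)⟩
  intro ε hε
  obtain ⟨g, hg, hfg⟩ := A.exists_ker_norm_sub_le ρ h (Fin.last l) ε hε
  have h1 : ρ f = ρ (f - g) := by rw [map_sub, hg, sub_zero]
  rw [h1, zero_add]
  exact (NonUnitalStarAlgHom.norm_apply_le ρ (f - g)).trans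
    (norm_le_of_coord hε.le fun i x => hfg i i.castSucc_lt_last x)

end RSHAlgebra

/-! ### Restriction to invariant families of closed sets. -/

theorem IsBlockDiag.unique {n t : ℕ} {m : Fin t → ℕ} {M M' : Matrix (Fin n) (Fin n) ℂ}
    {N N' : ∀ s, Matrix (Fin (m s)) (Fin (m s)) ℂ} (hM : IsBlockDiag M N) (hM' : IsBlockDiag M' N')
    (h : ∀ s, N s = N' s) : M = M' := by
  obtain rfl : N = N' := funext h
  obtain ⟨_, rfl⟩ := hM
  obtain ⟨_, rfl⟩ := hM'
  rfl

/-- A ⋆-homomorphism that identifies all elements identified by a surjective one factors through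
it. -/
noncomputable def StarAlgHom.liftOfSurjective {R A B C : Type*} [CommSemiring R]
    [Semiring A] [Algebra R A] [Star A] [Semiring B] [Algebra R B] [Star B]
    [Semiring C] [Algebra R C] [Star C] (f : A →⋆ₐ[R] B) (hf : Function.Surjective f)
    (g : A →⋆ₐ[R] C) (h : ∀ a a', f a = f a' → g a = g a') : B →⋆ₐ[R] C :=
  have key : ∀ a, g (Function.surjInv hf (f a)) = g a := fun a =>
    h _ _ (Function.surjInv_eq hf (f a))
  { toFun := fun b => g (Function.surjInv hf b)
    map_one' := by rw [← map_one f, key, map_one]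
    map_mul' := hf.forall₂.2 fun a a' => by rw [← map_mul, key, key, key, map_mul]
    map_zero' := by rw [← map_zero f, key, map_zero]
    map_add' := hf.forall₂.2 fun a a' => by rw [← map_add, key, key, key, map_add]
    commutes' := fun r => by rw [← AlgHomClass.commutes f, key, AlgHomClass.commutes]
    map_star' := hf.forall.2 fun a => by rw [← map_star, key, key, map_star] }

theorem StarAlgHom.liftOfSurjective_apply {R A B C : Type*} [CommSemiring R]
    [Semiring A] [Algebra R A] [Star A] [Semiring B] [Algebra R B] [Star B]
    [Semiring C] [Algebra R C] [Star C] (f : A →⋆ₐ[R] B) (hf : Function.Surjective f)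
    (g : A →⋆ₐ[R] C) (h : ∀ a a', f a = f a' → g a = g a') (a : A) :
    f.liftOfSurjective hf g h (f a) = g a :=
  h _ _ (Function.surjInv_eq hf (f a))

namespace BaseSystem

variable {l : ℕ} (S : BaseSystem.{u} l) (Z : ∀ i, TopologicalSpace.Closeds (S.X i))

variable {S} in
theorem coord_succ_ext {i : Fin l} {f g : S.Coord i.succ} (h : S.trunc i f = S.trunc i g)
    (h' : S.top i f = S.top i g) : f = g := by
  funext ⟨j, hj⟩
  rcases (Fin.castSucc_lt_succ_iff.1 hj).eq_or_lt with rfl | hji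
  · exact h'
  · exact congrFun h ⟨j, Fin.castSucc_lt_castSucc_iff.2 hji⟩

/-- Coordinate-wise restriction as a ⋆-homomorphism. -/
noncomputable def restrictCoordHom (k : Fin (l + 1)) : S.Coord k →⋆ₐ[ℂ] (S.restrict Z).Coord k where
  toFun := S.restrictCoord Z
  map_one' := rfl
  map_mul' _ _ := rfl
  map_zero' := rfl
  map_add' _ _ := rfl
  commutes' _ := rfl
  map_star' _ := rfl

/-- The inclusion `Z_i ∩ Y_i → Y_i`. -/
noncomputable def restrictInclusion (i : Fin l) : C((S.restrict Z).Y i, S.Y i) :=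
  ⟨fun y => ⟨y.1.1, y.2⟩, by fun_prop⟩

end BaseSystem

namespace DSHAlgebra

variable {l : ℕ} {S : BaseSystem.{u} l} (A : DSHAlgebra S)
  {Z : ∀ i, TopologicalSpace.Closeds (S.X i)}

/-- A family of closed sets `Z_i` is invariant if all points into which a point of some `Z_i ∩ Y_i`
decomposes lie in the family. -/
def IsInvariant (Z : ∀ i, TopologicalSpace.Closeds (S.X i)) : Prop :=
  ∀ (i : Fin l) (y : S.Y i), y.1 ∈ Z i → ∀ (t : ℕ)
    (p : Fin t → Σ j : {j : Fin l // j.castSucc < i.castSucc}, S.X j),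
    A.DecomposesInto i y p → ∀ s, (p s).2 ∈ Z (p s).1

variable {A}

/-- At a point of `Z_i ∩ Y_i` the pullback is a block sum of values at points of the family, so it
depends only on the restricted functions. This makes the new pullback maps well defined. -/
theorem IsInvariant.φ_eq (hZ : A.IsInvariant Z) {i : Fin l} {f g : A.stage i.castSucc}
    (h : S.restrictCoord Z f.1 = S.restrictCoord Z g.1) :
    (A.φ i f).comp (S.restrictInclusion Z i) = (A.φ i g).comp (S.restrictInclusion Z i) := by
  ext1 y
  obtain ⟨t, p, hp⟩ := A.exists_decomposition i (S.restrictInclusion Z i y)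
  refine (hp.2 f).unique (hp.2 g) fun s => ?_
  exact DFunLike.congr_fun (congrFun h (p s).1) ⟨(p s).2, hZ i _ y.1.2 t p hp s⟩

variable (A Z) in
/-- Coordinate-wise restriction of the elements of `A^{(k)}`. -/
noncomputable def restrictStage (k : Fin (l + 1)) :
    A.stage k →⋆ₐ[ℂ] (A.stage k).map (S.restrictCoordHom Z k) :=
  ((S.restrictCoordHom Z k).comp (A.stage k).subtype).codRestrict _ fun g => ⟨g, g.2, rfl⟩

variable (A Z) in
theorem restrictStage_surjective (k : Fin (l + 1)) : Function.Surjective (A.restrictStage Z k) := by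
  rintro ⟨_, g, hg, rfl⟩
  exact ⟨⟨g, hg⟩, rfl⟩

/-- The pullback maps of the restriction of a DSH algebra to an invariant family of closed sets. -/
noncomputable def IsInvariant.restrictφ (hZ : A.IsInvariant Z) (i : Fin l) :
    (A.stage i.castSucc).map (S.restrictCoordHom Z i.castSucc) →⋆ₐ[ℂ]
      C((S.restrict Z).Y i, (S.restrict Z).Mat i) :=
  (A.restrictStage Z i.castSucc).liftOfSurjective (A.restrictStage_surjective Z i.castSucc)
    ((ContinuousMap.compStarAlgHom' ℂ (S.Mat i) (S.restrictInclusion Z i)).comp (A.φ i))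
    fun _ _ h => hZ.φ_eq (congrArg Subtype.val h)

theorem IsInvariant.restrictφ_apply (hZ : A.IsInvariant Z) (i : Fin l) (g : A.stage i.castSucc) :
    hZ.restrictφ i (A.restrictStage Z i.castSucc g) =
      (A.φ i g).comp (S.restrictInclusion Z i) :=
  StarAlgHom.liftOfSurjective_apply ..

/-- The restriction of a DSH algebra to an invariant family of closed sets, as a recursive
subhomogeneous algebra. -/
noncomputable def IsInvariant.restrictRSH (hZ : A.IsInvariant Z) : RSHAlgebra (S.restrict Z) where
  stage k := (A.stage k).map (S.restrictCoordHom Z k)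
  φ := hZ.restrictφ
  mem_stage_succ i f := by
    constructor
    · rintro ⟨g, hg, rfl⟩
      obtain ⟨hg', h⟩ := (A.mem_stage_succ i g).1 hg
      refine ⟨⟨S.trunc i g, hg', rfl⟩, ?_⟩
      refine (hZ.restrictφ_apply i ⟨S.trunc i g, hg'⟩).trans ?_
      rw [h]
      rfl
    · rintro ⟨⟨g, hg, hgf⟩, h⟩
      have hgf' : S.restrictCoord Z g = (S.restrict Z).trunc i f := hgf
      have hφ : (A.φ i ⟨g, hg⟩).comp (S.restrictInclusion Z i) =
          ((S.restrict Z).top i f).restrict ((S.restrict Z).Y i) := by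
        rw [← hZ.restrictφ_apply i ⟨g, hg⟩]
        refine Eq.trans (congrArg _ ?_) h
        exact Subtype.ext hgf'
      -- The top coordinate of a lift is forced on `Y_i` by the pullback of `g` and on `Z_i` by `f`;
      -- the two agree on the overlap by `hφ`, so they glue and extend.
      obtain ⟨F, hF, hF'⟩ := ContinuousMap.exists_restrict_eq_and_restrict_eq (S.isClosed_Y i)
        (Z i).isClosed (A.φ i ⟨g, hg⟩) ((S.restrict Z).top i f)
        (fun x hxY hxZ => DFunLike.congr_fun hφ ⟨⟨x, hxZ⟩, hxY⟩)
      obtain ⟨G, hGg, hGF⟩ := S.exists_trunc_eq_top_eq i g F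
      refine ⟨G, (A.mem_stage_succ i G).2 ⟨hGg ▸ hg, ?_⟩, ?_⟩
      · rw [hGF, hF]
        congr 1
        exact Subtype.ext hGg
      · refine BaseSystem.coord_succ_ext ?_ ?_
        · rw [← hgf', ← hGg]
          rfl
        · rw [← hF', ← hGF]
          rfl

theorem IsInvariant.isBlockDiag_restrictφ (hZ : A.IsInvariant Z) {i : Fin l}
    {y : (S.restrict Z).Y i} {t : ℕ}
    {p : Fin t → Σ j : {j : Fin l // j.castSucc < i.castSucc}, S.X j}
    (hp : A.DecomposesInto i ⟨y.1.1, y.2⟩ p) (f : hZ.restrictRSH.stage i.castSucc) :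
    IsBlockDiag (hZ.restrictRSH.φ i f y) fun s =>
      f.1 (p s).1 ⟨(p s).2, hZ i _ y.1.2 t p hp s⟩ := by
  obtain ⟨g, rfl⟩ := A.restrictStage_surjective Z i.castSucc f
  have h : hZ.restrictRSH.φ i (A.restrictStage Z i.castSucc g) y = A.φ i g ⟨y.1.1, y.2⟩ :=
    DFunLike.congr_fun (hZ.restrictφ_apply i g) y
  rw [h]
  exact hp.2 g

/-- The restriction of a DSH algebra to an invariant family of closed sets. -/
noncomputable def IsInvariant.restrict (hZ : A.IsInvariant Z) : DSHAlgebra (S.restrict Z) where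
  toRSHAlgebra := hZ.restrictRSH
  exists_decomposition i y := by
    obtain ⟨t, p, hp⟩ := A.exists_decomposition i ⟨y.1.1, y.2⟩
    exact ⟨t, fun s => ⟨(p s).1, ⟨(p s).2, hZ i _ y.1.2 t p hp s⟩⟩, hp.1,
      hZ.isBlockDiag_restrictφ hp⟩

theorem IsInvariant.hasRestrictedPullbacks (hZ : A.IsInvariant Z) :
    A.HasRestrictedPullbacks Z hZ.restrict := fun i y t p hp =>
  ⟨hZ i _ y.1.2 t p hp, hZ.isBlockDiag_restrictφ hp⟩

theorem IsInvariant.exists_restrictCoord_eq (hZ : A.IsInvariant Z) {k : Fin (l + 1)}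
    (f : hZ.restrict.stage k) : ∃ g : A.stage k, S.restrictCoord Z g.1 = f.1 :=
  let ⟨g, hg, h⟩ := f.2
  ⟨⟨g, hg⟩, h⟩

/-- Coordinate-wise restriction to an invariant family of closed sets. -/
noncomputable def IsInvariant.restrictHom (hZ : A.IsInvariant Z) : A.alg →⋆ₙₐ[ℂ] hZ.restrict.alg where
  toFun a := ⟨S.restrictCoord Z (RSHAlgebra.tuple a), RSHAlgebra.tuple a, a.2, rfl⟩
  map_smul' _ _ := rfl
  map_zero' := rfl
  map_add' _ _ := rfl
  map_mul' _ _ := rfl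
  map_star' _ := rfl

theorem IsInvariant.tuple_restrictHom (hZ : A.IsInvariant Z) (a : A.alg) :
    RSHAlgebra.tuple (hZ.restrictHom a) = S.restrictCoord Z (RSHAlgebra.tuple a) := rfl

theorem IsInvariant.restrictHom_surjective (hZ : A.IsInvariant Z) :
    Function.Surjective hZ.restrictHom := fun f =>
  let ⟨g, hg⟩ := hZ.exists_restrictCoord_eq f
  ⟨g, Subtype.ext hg⟩

end DSHAlgebra

/-- Lets a point off `Y_i` count as its own decomposition. -/
theorem IsBlockDiag.single {n : ℕ} (M : Matrix (Fin n) (Fin n) ℂ) :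
    IsBlockDiag (m := fun _ : Fin 1 => n) M fun _ => M := by
  let e : (_ : Fin 1) × Fin n ≃ Fin n :=
    { toFun := fun x => x.2
      invFun := fun a => ⟨0, a⟩
      left_inv := fun x => Sigma.ext (Subsingleton.elim _ _) HEq.rfl
      right_inv := fun _ => rfl }
  refine isBlockDiag_iff.2 ⟨e, fun x y h => ?_, ?_⟩
  · cases h with
    | left _ _ h => exact absurd h (by simp)
    | right _ _ h => exact h
  · ext a b
    simp [e]

/-! ### Factorization through surjections, and irreducibility. -/

namespace NonUnitalStarAlgHom

variable {A B C : Type*} [NonUnitalCStarAlgebra A] [NonUnitalCStarAlgebra B]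
  [NonUnitalCStarAlgebra C]

theorem exists_comp_eq {f : A →⋆ₙₐ[ℂ] B} (hf : Function.Surjective f) (g : A →⋆ₙₐ[ℂ] C)
    (h : ∀ a, f a = 0 → g a = 0) : ∃ k : B →⋆ₙₐ[ℂ] C, k.comp f = g := by
  have key : ∀ a, g (Function.surjInv hf (f a)) = g a := fun a => by
    rw [← sub_eq_zero, ← map_sub]
    exact h _ (by rw [map_sub, Function.surjInv_eq hf, sub_self])
  let k : B →⋆ₙₐ[ℂ] C :=
    { toFun := fun b => g (Function.surjInv hf b)
      map_smul' := fun r => hf.forall.2 fun a => by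
        rw [MonoidHom.id_apply, ← map_smul, key, key, map_smul]
      map_mul' := hf.forall₂.2 fun a a' => by rw [← map_mul, key, key, key, map_mul]
      map_zero' := by rw [← map_zero f, key, map_zero]
      map_add' := hf.forall₂.2 fun a a' => by rw [← map_add, key, key, key, map_add]
      map_star' := hf.forall.2 fun a => by rw [← map_star, key, key, map_star] }
  exact ⟨k, NonUnitalStarAlgHom.ext key⟩

theorem injective_of_comp_eq {f : A →⋆ₙₐ[ℂ] B} (hf : Function.Surjective f) {g : A →⋆ₙₐ[ℂ] C}
    {k : B →⋆ₙₐ[ℂ] C} (hk : k.comp f = g) (h : ∀ a, g a = 0 → f a = 0) :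
    Function.Injective k := by
  refine (injective_iff_map_eq_zero k).2 (hf.forall.2 fun a ha => h a ?_)
  rw [← hk]
  exact ha

theorem exists_starAlgEquiv {f : A →⋆ₙₐ[ℂ] B} (hf : Function.Surjective f) {g : A →⋆ₙₐ[ℂ] C}
    (hg : Function.Surjective g) (h : ∀ a, f a = 0 ↔ g a = 0) :
    ∃ Γ : B ≃⋆ₐ[ℂ] C, ∀ a, Γ (f a) = g a := by
  obtain ⟨k, hk⟩ := exists_comp_eq hf g fun a => (h a).1
  refine ⟨StarAlgEquiv.ofBijective k
    ⟨injective_of_comp_eq hf hk fun a => (h a).2, fun c => ?_⟩, fun a => DFunLike.congr_fun hk a⟩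
  obtain ⟨a, rfl⟩ := hg c
  exact ⟨f a, DFunLike.congr_fun hk a⟩

end NonUnitalStarAlgHom

theorem isIrreducibleRep_of_surjective {B : Type v} [NonUnitalCStarAlgebra B] {H : Type w}
    [NormedAddCommGroup H] [InnerProductSpace ℂ H] [CompleteSpace H] [Nontrivial H]
    {π : B →⋆ₙₐ[ℂ] (H →L[ℂ] H)} (hπ : Function.Surjective π) : IsIrreducibleRep π := by
  refine ⟨?_, fun K _ hK => ?_⟩
  · rintro rfl
    obtain ⟨b, hb⟩ := hπ 1
    exact zero_ne_one hb
  · rw [or_iff_not_imp_left, Submodule.eq_bot_iff]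
    push Not
    rintro ⟨ξ, hξ, hξ0⟩
    refine Submodule.eq_top_iff'.2 fun η => ?_
    -- A rank-one operator carrying `ξ` to the arbitrary vector `η`.
    obtain ⟨b, hb⟩ := hπ ((innerSL ℂ ξ).smulRight ((inner ℂ ξ ξ)⁻¹ • η))
    have := hK b ξ hξ
    rw [hb] at this
    simpa [smul_smul, hξ0] using this

/-! ### The spectrum of a quotient and hull families. -/

namespace DSHAlgebra

variable {l : ℕ} {S : BaseSystem.{u} l} (A : DSHAlgebra S) {B : Type v} [NonUnitalCStarAlgebra B]

/-- If `ev_x` is equivalent to some `π ∘ ρ`, it kills `ker ρ`. Conversely, if it kills `ker ρ`, it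
factors through `B`, and the factor is onto the full operator algebra, hence irreducible. -/
theorem spectrumPoints_eq_hull {ρ : A.alg →⋆ₙₐ[ℂ] B} (hρ : Function.Surjective ρ) (i : Fin l) :
    A.spectrumPoints ρ i = A.hull ρ i := by
  ext x
  constructor
  · rintro ⟨hx, H, _, _, _, π, -, U, hU⟩
    refine ⟨hx, fun f hf => ?_⟩
    have : A.ev i x f = 0 := by
      ext1 ξ
      obtain ⟨η, rfl⟩ := U.surjective ξ
      rw [← hU f η]
      simp [hf]
    exact (map_eq_zero_iff _ (Matrix.toEuclideanCLM (𝕜 := ℂ) (n := Fin (S.n i))).injective).1 this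
  · rintro ⟨hx, hρx⟩
    have : NeZero (S.n i) := ⟨(S.n_pos i).ne'⟩
    obtain ⟨π, hπ⟩ := NonUnitalStarAlgHom.exists_comp_eq hρ (A.ev i x) fun f hf =>
      (congrArg (Matrix.toEuclideanCLM (𝕜 := ℂ)) (hρx f hf)).trans (map_zero _)
    refine ⟨hx, EuclideanSpace ℂ (Fin (S.n i)), inferInstance, inferInstance, inferInstance, π,
      isIrreducibleRep_of_surjective fun T => ?_, .refl ℂ _, fun b ξ => ?_⟩
    · obtain ⟨M, rfl⟩ := (Matrix.toEuclideanCLM (𝕜 := ℂ) (n := Fin (S.n i))).surjective T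
      obtain ⟨f, rfl⟩ := A.exists_coord_apply_eq hx M
      exact ⟨ρ f, DFunLike.congr_fun hπ f⟩
    · rw [hπ]
      rfl

/-- The closed sets `Z_i` contain all points off the `Y_i` at which `ker ρ` vanishes, and `ker ρ`
vanishes at all their points. -/
structure IsHullFamily (ρ : A.alg →⋆ₙₐ[ℂ] B) (Z : ∀ i, TopologicalSpace.Closeds (S.X i)) :
    Prop where
  hull_subset : ∀ i, A.hull ρ i ⊆ Z i
  coord_eq_zero : ∀ i, ∀ x ∈ Z i, ∀ f, ρ f = 0 → RSHAlgebra.coord f i x = 0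

variable {A}

/-- Vanishing passes to the closure by continuity. As `ρ` is arbitrary here, this also serves the
canonical maps of an inductive limit. -/
theorem isHullFamily_closure_hull (ρ : A.alg →⋆ₙₐ[ℂ] B) :
    A.IsHullFamily ρ fun i => TopologicalSpace.Closeds.closure (A.hull ρ i) where
  hull_subset _ := subset_closure
  coord_eq_zero i _ hx f hf :=
    closure_minimal (s := A.hull ρ i) (t := {x | RSHAlgebra.coord f i x = 0}) (fun _ hy => hy.2 f hf)
      (isClosed_eq (RSHAlgebra.coord f i).continuous continuous_const) hx

theorem isHullFamily_quotientSpace {ρ : A.alg →⋆ₙₐ[ℂ] B} (hρ : Function.Surjective ρ) :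
    A.IsHullFamily ρ (A.quotientSpace ρ) := by
  have : A.quotientSpace ρ = fun i => TopologicalSpace.Closeds.closure (A.hull ρ i) :=
    funext fun i => congrArg _ (A.spectrumPoints_eq_hull hρ i)
  rw [this]
  exact isHullFamily_closure_hull ρ

namespace IsHullFamily

variable {ρ : A.alg →⋆ₙₐ[ℂ] B} {Z : ∀ i, TopologicalSpace.Closeds (S.X i)}

/-- The kernel vanishes at `y`, hence in every block of its decomposition; the block points are off
the `Y_j` and so belong to the hull. -/
theorem isInvariant (h : A.IsHullFamily ρ Z) : A.IsInvariant Z := by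
  intro i y hy t p hp s
  refine h.hull_subset _ ⟨hp.1 s, fun f hf => ?_⟩
  have h0 := h.coord_eq_zero i y hy f hf
  rw [← A.φ_truncate f i y] at h0
  exact (hp.2 _).eq_zero_iff.1 h0 s

theorem map_eq_zero_iff (h : A.IsHullFamily ρ Z) (f : A.alg) :
    ρ f = 0 ↔ S.restrictCoord Z (RSHAlgebra.tuple f) = 0 := by
  rw [A.toRSHAlgebra.map_eq_zero_iff]
  constructor
  · intro hf
    funext j
    ext1 x
    exact h.coord_eq_zero j.1 x.1 x.2 f ((A.toRSHAlgebra.map_eq_zero_iff ρ f).2 hf)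
  · intro hf i x hx
    exact DFunLike.congr_fun (congrFun hf ⟨i, i.castSucc_lt_last⟩) ⟨x, h.hull_subset i hx⟩

theorem restrictHom_eq_zero_iff (h : A.IsHullFamily ρ Z) (f : A.alg) :
    h.isInvariant.restrictHom f = 0 ↔ ρ f = 0 := by
  rw [h.map_eq_zero_iff]
  exact Subtype.ext_iff

end IsHullFamily

theorem exists_decomposition_coord (A : DSHAlgebra S) (i : Fin l) (x : S.X i) :
    ∃ (t : ℕ) (p : Fin t → Σ j, S.X j), (∀ s, (p s).2 ∉ S.Y (p s).1) ∧
      ∀ f : A.alg, IsBlockDiag (RSHAlgebra.coord f i x)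
        fun s => RSHAlgebra.coord f (p s).1 (p s).2 := by
  by_cases hx : x ∈ S.Y i
  · obtain ⟨t, p, hp⟩ := A.exists_decomposition i ⟨x, hx⟩
    refine ⟨t, fun s => ⟨(p s).1, (p s).2⟩, hp.1, fun f => ?_⟩
    rw [← A.φ_truncate f i ⟨x, hx⟩]
    exact hp.2 _
  · exact ⟨1, fun _ => ⟨i, x⟩, fun _ => hx, fun f => .single _⟩

end DSHAlgebra

/-! ### Descent of diagonal maps. -/

section Diagonal

variable {l₁ l₂ : ℕ} {S₁ : BaseSystem.{u} l₁} {S₂ : BaseSystem.{u} l₂}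
  {A₁ : DSHAlgebra S₁} {A₂ : DSHAlgebra S₂} {ψ : A₁.alg →⋆ₙₐ[ℂ] A₂.alg}

/-- A diagonal map may use points of the `Y_j`, which the hull excludes by definition; decomposing
these once more and flattening removes them. -/
theorem IsDiagonalMap.exists_notMem (hψ : IsDiagonalMap ψ) (i : Fin l₂) (x : S₂.X i) :
    ∃ (t : ℕ) (p : Fin t → Σ j, S₁.X j), (∀ s, (p s).2 ∉ S₁.Y (p s).1) ∧
      ∀ f : A₁.alg, IsBlockDiag (RSHAlgebra.coord (ψ f) i x)
        fun s => RSHAlgebra.coord f (p s).1 (p s).2 := by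
  obtain ⟨t, p, hp⟩ := hψ i x
  choose r q hqY hq using fun s => A₁.exists_decomposition_coord (p s).1 (p s).2
  exact ⟨∑ s, r s, fun u => q (finSigmaFinEquiv.symm u).1 (finSigmaFinEquiv.symm u).2,
    fun u => hqY _ _, fun f => (hp f).flatten fun s => hq s f⟩

/-- Stated for arbitrary restriction maps `κ₁`, `κ₂`, so that it covers both `Γ ∘ ρ` and plain
restriction in the inductive limit. -/
theorem IsDiagonalMap.exists_descent {B₁ B₂ : Type v} [NonUnitalCStarAlgebra B₁]
    [NonUnitalCStarAlgebra B₂] {ρ₁ : A₁.alg →⋆ₙₐ[ℂ] B₁} {ρ₂ : A₂.alg →⋆ₙₐ[ℂ] B₂}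
    (hψ : IsDiagonalMap ψ) (hker : ∀ a, ρ₁ a = 0 → ρ₂ (ψ a) = 0)
    {Z₁ : ∀ i, TopologicalSpace.Closeds (S₁.X i)} {Z₂ : ∀ i, TopologicalSpace.Closeds (S₂.X i)}
    (hZ₁ : A₁.IsHullFamily ρ₁ Z₁) (hZ₂ : A₂.IsHullFamily ρ₂ Z₂)
    {D₁ : DSHAlgebra (S₁.restrict Z₁)} {D₂ : DSHAlgebra (S₂.restrict Z₂)}
    {κ₁ : A₁.alg →⋆ₙₐ[ℂ] D₁.alg} {κ₂ : A₂.alg →⋆ₙₐ[ℂ] D₂.alg} (hs : Function.Surjective κ₁)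
    (hκ₁ : ∀ a, RSHAlgebra.tuple (κ₁ a) = S₁.restrictCoord Z₁ (RSHAlgebra.tuple a))
    (hκ₂ : ∀ a, RSHAlgebra.tuple (κ₂ a) = S₂.restrictCoord Z₂ (RSHAlgebra.tuple a)) :
    ∃ ψ' : D₁.alg →⋆ₙₐ[ℂ] D₂.alg, IsDiagonalMap ψ' ∧ ψ'.comp κ₁ = κ₂.comp ψ ∧
      ((∀ a, ρ₂ (ψ a) = 0 → ρ₁ a = 0) → Function.Injective ψ') := by
  have h₁ : ∀ a, κ₁ a = 0 ↔ ρ₁ a = 0 := fun a => by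
    rw [hZ₁.map_eq_zero_iff, ← hκ₁]
    exact Subtype.ext_iff
  have h₂ : ∀ a, κ₂ a = 0 ↔ ρ₂ a = 0 := fun a => by
    rw [hZ₂.map_eq_zero_iff, ← hκ₂]
    exact Subtype.ext_iff
  obtain ⟨ψ', hψ'⟩ := NonUnitalStarAlgHom.exists_comp_eq hs (κ₂.comp ψ) fun a ha =>
    (h₂ _).2 (hker a ((h₁ a).1 ha))
  refine ⟨ψ', fun i x => ?_, hψ', fun hinj =>
    NonUnitalStarAlgHom.injective_of_comp_eq hs hψ' fun a ha => (h₁ a).2 (hinj a ((h₂ _).1 ha))⟩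
  obtain ⟨t, p, hpY, hp⟩ := hψ.exists_notMem i x.1
  -- `ψ` maps `ker ρ₁` into `ker ρ₂`, which vanishes at `x`; so `ker ρ₁` vanishes at every block
  -- point.
  have hpZ : ∀ s, (p s).2 ∈ Z₁ (p s).1 := fun s =>
    hZ₁.hull_subset _ ⟨hpY s, fun f hf =>
      (hp f).eq_zero_iff.1 (hZ₂.coord_eq_zero i x.1 x.2 _ (hker f hf)) s⟩
  refine ⟨t, fun s => ⟨(p s).1, ⟨(p s).2, hpZ s⟩⟩, hs.forall.2 fun f => ?_⟩
  have e₁ : (fun s => RSHAlgebra.coord f (p s).1 (p s).2) =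
      fun s => RSHAlgebra.coord (κ₁ f) (p s).1 ⟨(p s).2, hpZ s⟩ := funext fun s =>
    (DFunLike.congr_fun (congrFun (hκ₁ f) ⟨(p s).1, (p s).1.castSucc_lt_last⟩)
      ⟨(p s).2, hpZ s⟩).symm
  have e₂ : RSHAlgebra.coord (ψ' (κ₁ f)) i x = RSHAlgebra.coord (ψ f) i x.1 := by
    rw [show ψ' (κ₁ f) = κ₂ (ψ f) from DFunLike.congr_fun hψ' f]
    exact DFunLike.congr_fun (congrFun (hκ₂ (ψ f)) ⟨i, i.castSucc_lt_last⟩) x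
  rw [e₂]
  exact Eq.mp (congrArg (IsBlockDiag _) e₁) (hp f)

end Diagonal

/-! ### Inductive limits. -/

/-- Compatible maps out of the `D n` pull back along `κ` to compatible maps out of the `A n`;
surjectivity of `κ` allows it to be cancelled afterwards. -/
theorem IsInductiveLimit.of_surjective {A D : ℕ → Type u} [∀ n, NonUnitalCStarAlgebra (A n)]
    [∀ n, NonUnitalCStarAlgebra (D n)] {ψ : ∀ n, A n →⋆ₙₐ[ℂ] A (n + 1)}
    {ψ' : ∀ n, D n →⋆ₙₐ[ℂ] D (n + 1)} {L : Type v} [NonUnitalCStarAlgebra L]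
    {μ : ∀ n, A n →⋆ₙₐ[ℂ] L} {μ' : ∀ n, D n →⋆ₙₐ[ℂ] L} (h : IsInductiveLimit A ψ L μ)
    {κ : ∀ n, A n →⋆ₙₐ[ℂ] D n} (hκ : ∀ n, Function.Surjective (κ n))
    (hψ : ∀ n, (ψ' n).comp (κ n) = (κ (n + 1)).comp (ψ n)) (hμ : ∀ n, (μ' n).comp (κ n) = μ n) :
    IsInductiveLimit D ψ' L μ' where
  compatible n := by
    refine NonUnitalStarAlgHom.ext ((hκ n).forall.2 fun a => ?_)
    have h1 := DFunLike.congr_fun (hψ n) a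
    have h2 := DFunLike.congr_fun (hμ (n + 1)) (ψ n a)
    have h3 := DFunLike.congr_fun (h.compatible n) a
    have h4 := DFunLike.congr_fun (hμ n) a
    simp only [NonUnitalStarAlgHom.comp_apply] at h1 h2 h3 h4 ⊢
    rw [h1, h2, h3, h4]
  universal C _ ν hν := by
    obtain ⟨χ, hχ, huniq⟩ := h.universal C (fun n => (ν n).comp (κ n)) fun n => by
      rw [NonUnitalStarAlgHom.comp_assoc, ← hψ, ← NonUnitalStarAlgHom.comp_assoc, hν]
    refine ⟨χ, fun n => NonUnitalStarAlgHom.ext ((hκ n).forall.2 fun a => ?_), fun χ' hχ' =>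
      huniq χ' fun n => ?_⟩
    · have h1 := DFunLike.congr_fun (hχ n) a
      have h2 := DFunLike.congr_fun (hμ n) a
      simp only [NonUnitalStarAlgHom.comp_apply] at h1 h2 ⊢
      rw [h2, h1]
    · rw [← hμ, ← NonUnitalStarAlgHom.comp_assoc, hχ']

theorem mainTheorem5 :
    -- every quotient of a DSH algebra is canonically a DSH algebra
    (∀ (l : ℕ) (S : BaseSystem.{u} l) (A : DSHAlgebra S) (B : Type v) [NonUnitalCStarAlgebra B]
      (ρ : A.alg →⋆ₙₐ[ℂ] B), Function.Surjective ρ →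
      ∃ D : DSHAlgebra (A.quotientBase ρ),
        A.HasRestrictedPullbacks (A.quotientSpace ρ) D ∧
        (∀ (k : Fin (l + 1)) (f : D.stage k), ∃ g : A.stage k,
          S.restrictCoord (A.quotientSpace ρ) g.1 = f.1) ∧
        ∃ Γ : B ≃⋆ₐ[ℂ] D.alg, A.IsCanonicalIso ρ (A.quotientSpace ρ) D Γ) ∧
    -- diagonal maps descend to diagonal maps between these quotients
    (∀ (l₁ l₂ : ℕ) (S₁ : BaseSystem.{u} l₁) (S₂ : BaseSystem.{u} l₂)
      (A₁ : DSHAlgebra S₁) (A₂ : DSHAlgebra S₂)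
      (B₁ B₂ : Type v) [NonUnitalCStarAlgebra B₁] [NonUnitalCStarAlgebra B₂]
      (ρ₁ : A₁.alg →⋆ₙₐ[ℂ] B₁) (ρ₂ : A₂.alg →⋆ₙₐ[ℂ] B₂)
      (ψ : A₁.alg →⋆ₙₐ[ℂ] A₂.alg),
      Function.Surjective ρ₁ → Function.Surjective ρ₂ → IsDiagonalMap ψ →
      (∀ a, ρ₁ a = 0 → ρ₂ (ψ a) = 0) →
      ∀ (D₁ : DSHAlgebra (A₁.quotientBase ρ₁)) (D₂ : DSHAlgebra (A₂.quotientBase ρ₂))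
        (Γ₁ : B₁ ≃⋆ₐ[ℂ] D₁.alg) (Γ₂ : B₂ ≃⋆ₐ[ℂ] D₂.alg),
        A₁.IsCanonicalIso ρ₁ (A₁.quotientSpace ρ₁) D₁ Γ₁ →
        A₂.IsCanonicalIso ρ₂ (A₂.quotientSpace ρ₂) D₂ Γ₂ →
        ∃ ψ' : D₁.alg →⋆ₙₐ[ℂ] D₂.alg,
          IsDiagonalMap ψ' ∧ (∀ a : A₁.alg, ψ' (Γ₁ (ρ₁ a)) = Γ₂ (ρ₂ (ψ a))) ∧
          ((∀ a, ρ₂ (ψ a) = 0 → ρ₁ a = 0) → Function.Injective ψ')) ∧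
    -- inductive limits can be rewritten with injective diagonal bonding maps
    (∀ (l : ℕ → ℕ) (S : ∀ n, BaseSystem.{u} (l n)) (A : ∀ n, DSHAlgebra (S n))
      (ψ : ∀ n, (A n).alg →⋆ₙₐ[ℂ] (A (n + 1)).alg), (∀ n, IsDiagonalMap (ψ n)) →
      ∀ (L : Type v) [NonUnitalCStarAlgebra L] (μ : ∀ n, (A n).alg →⋆ₙₐ[ℂ] L),
      IsInductiveLimit (fun n => (A n).alg) ψ L μ →
      ∃ (Z : ∀ n i, TopologicalSpace.Closeds ((S n).X i))
        (D : ∀ n, DSHAlgebra ((S n).restrict (Z n)))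
        (ψ' : ∀ n, (D n).alg →⋆ₙₐ[ℂ] (D (n + 1)).alg) (μ' : ∀ n, (D n).alg →⋆ₙₐ[ℂ] L),
        (∀ n, IsDiagonalMap (ψ' n)) ∧ (∀ n, Function.Injective (ψ' n)) ∧
        IsInductiveLimit (fun n => (D n).alg) ψ' L μ' ∧
        -- the new algebras are the canonical quotients of the old ones by the kernels of the `μ n`
        ∃ κ : ∀ n, (A n).alg →⋆ₙₐ[ℂ] (D n).alg,
          (∀ n, (A n).HasRestrictedPullbacks (Z n) (D n)) ∧
          (∀ n, Function.Surjective (κ n)) ∧ (∀ n a, κ n a = 0 ↔ μ n a = 0) ∧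
          (∀ n a, RSHAlgebra.tuple (κ n a) = (S n).restrictCoord (Z n) (RSHAlgebra.tuple a)) ∧
          (∀ n, (ψ' n).comp (κ n) = (κ (n + 1)).comp (ψ n)) ∧
          (∀ n, (μ' n).comp (κ n) = μ n)) := by

  refine ⟨fun l S A B _ ρ hρ => ?_, ?_, ?_⟩
  · have h := DSHAlgebra.isHullFamily_quotientSpace hρ
    exact ⟨h.isInvariant.restrict, h.isInvariant.hasRestrictedPullbacks,
      fun k f => h.isInvariant.exists_restrictCoord_eq f,
      let ⟨Γ, hΓ⟩ := NonUnitalStarAlgHom.exists_starAlgEquiv hρ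
        h.isInvariant.restrictHom_surjective fun a => (h.restrictHom_eq_zero_iff a).symm
      ⟨Γ, fun a => by rw [hΓ]; rfl⟩⟩
  · intro l₁ l₂ S₁ S₂ A₁ A₂ B₁ B₂ _ _ ρ₁ ρ₂ ψ hρ₁ hρ₂ hψ hker D₁ D₂ Γ₁ Γ₂ hΓ₁ hΓ₂
    obtain ⟨ψ', hdiag, hcomp, hinj⟩ := hψ.exists_descent hker
      (DSHAlgebra.isHullFamily_quotientSpace hρ₁) (DSHAlgebra.isHullFamily_quotientSpace hρ₂)
      (κ₁ := (Γ₁ : B₁ →⋆ₙₐ[ℂ] D₁.alg).comp ρ₁) (κ₂ := (Γ₂ : B₂ →⋆ₙₐ[ℂ] D₂.alg).comp ρ₂)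
      (Γ₁.surjective.comp hρ₁) hΓ₁ hΓ₂
    exact ⟨ψ', hdiag, fun a => DFunLike.congr_fun hcomp a, hinj⟩
  · intro l S A ψ hψ L _ μ hμ
    -- Compatibility gives `ker (μ n) = ψ_n⁻¹(ker (μ (n + 1)))`: one inclusion yields the descended
    -- map, the other its injectivity.
    have hcomp : ∀ n a, μ (n + 1) (ψ n a) = μ n a := fun n a =>
      DFunLike.congr_fun (hμ.compatible n) a
    have h := fun n => DSHAlgebra.isHullFamily_closure_hull (μ n)
    have hs := fun n => (h n).isInvariant.restrictHom_surjective
    choose ψ' hdiag hψ' hinj using fun n => (hψ n).exists_descent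
      (fun a ha => (hcomp n a).trans ha) (h n) (h (n + 1)) (hs n)
      (h n).isInvariant.tuple_restrictHom (h (n + 1)).isInvariant.tuple_restrictHom
    choose μ' hμ' using fun n => NonUnitalStarAlgHom.exists_comp_eq (hs n) (μ n)
      fun a => ((h n).restrictHom_eq_zero_iff a).1
    exact ⟨_, fun n => (h n).isInvariant.restrict, ψ', μ', hdiag,
      fun n => hinj n fun a ha => (hcomp n a).symm.trans ha, hμ.of_surjective hs hψ' hμ',
      fun n => (h n).isInvariant.restrictHom, fun n => (h n).isInvariant.hasRestrictedPullbacks, hs,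
      fun n => (h n).restrictHom_eq_zero_iff, fun n => (h n).isInvariant.tuple_restrictHom,
      hψ', hμ'⟩
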